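/- **Setting.** Let $U\subset\mathbb R^m$ and $\mathcal S\subset\mathbb R^n$ be convex, compact and nonempty, $t_0<t_f$, and let $A(t)\in\mathbb R^{n\times n}$, $B(t)\in\mathbb R^{n\times m}$ be integrable on every compact subinterval of $[t_0,\infty)$. For measurable $u:[t_0,\infty)\to U$ let $y(\cdot,y_0,u)$ be the solution of $\dot y=A(t)y+B(t)u(t)$ a.e., $y(t_0)=y_0$. Put $$\mathcal R(t)=\{y_0:\ y(t,y_0,u)\in\mathcal S\text{ for some }u\},\qquad T(y_0)=\inf_u\,\min\{t\ge t_0:\ y(t,y_0,u)\in\mathcal S\}\in[t_0,\infty],$$ and assume that $\mathcal R(s)\subset\operatorname{int}\mathcal R(t)$ whenever $t_0\le s<t\le t_f$. **Discretization.** Let $K,N\ge1$, $\Delta t=(t_f-t_0)/K$, $h=\Delta t/N$, $t_i=t_0+i\Delta t$, $t_{ij}=t_i+jh$, $\bar B(t)=-B(t_0+t_f-t)$. Let $c_0,\dots,c_N\ge 0$ be quadrature weights, let the matrices $\Phi_h(t,s)\in\mathbb R^{n\times n}$ be given (approximations of the fundamental matrix of $\dot y=-A(t_0+t_f-t)y$),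 and let $l^1,\dots,l^{N_{\mathcal R}}\in\mathbb R^n$, $\eta^1,\dots,\eta^{N_U}\in\mathbb R^m$ be unit vectors. A supporting point of a set $M$ in direction $l$ is any maximizer of $\langle l,\cdot\rangle$ on $M$. Let $\widetilde U_\Delta$ consist of one supporting point of $U$ in each direction $\eta^r$, let $Y_{h\Delta}(t_0)$ consist of one supporting point of $\mathcal S$ in each direction $l^k$, and for $i=0,\dots,K-1$ let $Y_{h\Delta}(t_{i+1})$ consist of one supporting point, in each direction $l^k$, of $$\operatorname{co}\Big(\Phi_h(t_{i+1},t_i)Y_{h\Delta}(t_i)+h\sum_{j=0}^N c_j\Phi_h(t_{i+1},t_{ij})\bar B(t_{ij})\widetilde U_\Delta\Big).$$ Put $\mathcal R_{h\Delta}(t_i)=\operatorname{co}Y_{h\Delta}(t_i)$ and $\Omega=\bigcup_{i=0}^K\mathcal R_{h\Delta}(t_i)$. Given a finite simplicial triangulation $\Gamma$, into $n$-simplices, of $\Omega\setminus\operatorname{int}\mathcal R_{h\Delta}(t_0)$ whose set of vertices is $\bigcup_{i=0}^K Y_{h\Delta}(t_i)$ and each of whose simplices lies in $\mathcal R_{h\Delta}(t_{i+1})\setminus\operatorname{int}\mathcal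 R_{h\Delta}(t_i)$ for some $i\in\{0,\dots,K-1\}$, let $T_{h\Delta}:\Omega\to\mathbb R$ be $t_0$ on $\mathcal R_{h\Delta}(t_0)$, $t_i$ on $\partial\mathcal R_{h\Delta}(t_i)$ for $i=1,\dots,K$, and at all other points of $\Omega$ the piecewise linear interpolation over $\Gamma$ of these values at the vertices. **Statement.** Let $C\ge0$, $p\in\mathbb R$, $\varepsilon>0$ be such that the Hausdorff distance satisfies $d_H(\mathcal R_{h\Delta}(t_i),\mathcal R(t_i))\le Ch^p$ for $i=0,\dots,K$, that $$\mathcal R(t_i)+\varepsilon B_1(0)\subset\operatorname{int}\mathcal R(t_{i+1})\qquad(i=0,\dots,K-1),\tag{1}$$ where $B_1(0)$ is the closed unit ball, and that $Ch^p<\varepsilon/3$. Then $$\mathcal R_{h\Delta}(t_i)+\tfrac{\varepsilon}{3}B_1(0)\subset\operatorname{int}\mathcal R_{h\Delta}(t_{i+1})\qquad(i=0,\dots,K-1).$$ Moreover, for every triangulation $\Gamma$ as above, $|T(x)-T_{h\Delta}(x)|\le2\Delta t$ (with $T(x)<\infty$) for every $x\in\Omega$ which lies in $\mathcal R_{h\Delta}(t_i)$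 for some $i<K$ or satisfies $T(x)\le t_f+\Delta t$. If (1) holds also for $i=K$, with $t_{K+1}=t_f+\Delta t$, then $T$ is finite on all of $\Omega$ and $$\|T-T_{h\Delta}\|_{\infty,\Omega}=\sup_{x\in\Omega}|T(x)-T_{h\Delta}(x)|\le2\Delta t .$$ No modulus of continuity of $T$ is assumed. -/

import Mathlib

open scoped Pointwise

noncomputable section

/-- Euclidean space `ℝⁿ`. -/
abbrev Euc (n : ℕ) : Type := EuclideanSpace ℝ (Fin n)

/-- The data of the linear control problem `y' = A(t) y + B(t) u`, `u(t) ∈ U`, on `[t₀, ∞)`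
with target set `S`. -/
structure LinearControlSystem (n m : ℕ) where
  t₀ : ℝ
  A : ℝ → Matrix (Fin n) (Fin n) ℝ
  B : ℝ → Matrix (Fin n) (Fin m) ℝ
  U : Set (Euc m)
  S : Set (Euc n)

namespace LinearControlSystem

variable {n m : ℕ} (P : LinearControlSystem n m)

/-- Admissible controls: measurable functions with values in `U` on `[t₀, ∞)`
(the values before `t₀` are irrelevant). -/
def IsAdmissible (u : ℝ → Euc m) : Prop :=
  Measurable u ∧ ∀ t, P.t₀ ≤ t → u t ∈ P.U

/-- `y` is the (Carathéodory) solution on `[t₀, ∞)` of `y' = A y + B u` a.e., `y(t₀) = y₀`,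
in integrated form. -/
def IsSolution (y₀ : Euc n) (u : ℝ → Euc m) (y : ℝ → Euc n) : Prop :=
  ContinuousOn y (Set.Ici P.t₀) ∧
    ∀ t, P.t₀ ≤ t →
      y t = y₀ + ∫ s in P.t₀..t,
        (Matrix.toEuclideanLin (P.A s) (y s) + Matrix.toEuclideanLin (P.B s) (u s))

/-- The reachable set for fixed end time `t`: the starting points (at time `t₀`) from which some
admissible control steers the system into the target at time `t`. -/
def reach (t : ℝ) : Set (Euc n) :=
  {y₀ | P.t₀ ≤ t ∧ ∃ u y, P.IsAdmissible u ∧ P.IsSolution y₀ u y ∧ y t ∈ P.S}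

/-- First time `t ≥ t₀` at which the trajectory `y` is in the target (`⊤` if there is none). -/
def hitTime (y : ℝ → Euc n) : EReal :=
  ⨅ (t : ℝ) (_ : P.t₀ ≤ t ∧ y t ∈ P.S), (t : EReal)

/-- The minimum time function, with values in `[t₀, ∞]`. -/
def minTime (y₀ : Euc n) : EReal :=
  ⨅ (u : ℝ → Euc m) (y : ℝ → Euc n) (_ : P.IsAdmissible u ∧ P.IsSolution y₀ u y), P.hitTime y

/-- The standing assumptions (i)-(iv) on the control problem up to the final time `tf`. -/
structure StandingAssumptions (tf : ℝ) : Prop where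
  t₀_lt : P.t₀ < tf
  integrable_A : ∀ i j b, MeasureTheory.IntegrableOn (fun t => P.A t i j) (Set.Icc P.t₀ b)
  integrable_B : ∀ i j b, MeasureTheory.IntegrableOn (fun t => P.B t i j) (Set.Icc P.t₀ b)
  U_convex : Convex ℝ P.U
  U_compact : IsCompact P.U
  U_nonempty : P.U.Nonempty
  S_convex : Convex ℝ P.S
  S_compact : IsCompact P.S
  S_nonempty : P.S.Nonempty
  strictly_expanding : ∀ t₁ t₂, P.t₀ ≤ t₁ → t₁ < t₂ → t₂ ≤ tf →
    P.reach t₁ ⊆ interior (P.reach t₂)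

end LinearControlSystem

/-- The supporting face of `A` in the direction `l`: the maximizers of `⟨l, ·⟩` on `A`. -/
def supportFace {n : ℕ} (l : Euc n) (A : Set (Euc n)) : Set (Euc n) :=
  {x | x ∈ A ∧ ∀ z ∈ A, inner ℝ l z ≤ inner ℝ l x}

/-- The parameters of the full discretization: the final time, `K` macro steps, each divided into
`N` steps of the numerical scheme; approximations `Φh t s` of the fundamental matrix of the
time-reversed system; quadrature weights `c 0, …, c N`; finitely many unit directions `l k` in the
state space and `η r` in the control space. -/
structure Discretization (n m : ℕ) where
  tf : ℝ
  K : ℕ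
  N : ℕ
  K_pos : 0 < K
  N_pos : 0 < N
  Φh : ℝ → ℝ → Matrix (Fin n) (Fin n) ℝ
  c : ℕ → ℝ
  c_nonneg : ∀ j, 0 ≤ c j
  numR : ℕ
  numU : ℕ
  l : Fin numR → Euc n
  η : Fin numU → Euc m
  l_unit : ∀ k, ‖l k‖ = 1
  η_unit : ∀ r, ‖η r‖ = 1

namespace Discretization

variable {n m : ℕ} (D : Discretization n m) (P : LinearControlSystem n m)

/-- `Δt = (tf - t₀) / K`. -/
def dt : ℝ := (D.tf - P.t₀) / D.K

/-- `h = Δt / N`. -/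
def h : ℝ := D.dt P / D.N

/-- `t_i = t₀ + i Δt`. -/
def time (i : ℕ) : ℝ := P.t₀ + i * D.dt P

/-- `t_{ij} = t_i + j h`. -/
def subtime (i j : ℕ) : ℝ := D.time P i + j * D.h P

/-- The control matrix `t ↦ -B(t₀ + tf - t)` of the time-reversed system. -/
def Bbar (t : ℝ) : Matrix (Fin n) (Fin m) ℝ := -P.B (P.t₀ + D.tf - t)

/-- One macro step applied to a set `Y` of points, with discretized control set `V`:
`Φ_h(t_{i+1}, t_i) Y + h ∑_{j=0}^N c_j Φ_h(t_{i+1}, t_{ij}) B̄(t_{ij}) V` (Minkowski sums). -/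
def macroStep (V : Set (Euc m)) (i : ℕ) (Y : Set (Euc n)) : Set (Euc n) :=
  Matrix.toEuclideanLin (D.Φh (D.time P (i + 1)) (D.time P i)) '' Y +
    D.h P • ∑ j ∈ Finset.range (D.N + 1), D.c j •
      (Matrix.toEuclideanLin
        (D.Φh (D.time P (i + 1)) (D.subtime P i j) * D.Bbar P (D.subtime P i j)) '' V)

/-- `v` and `y` record the choices of supporting points made in a run of the algorithm: `v r` is
a supporting point of `U` in direction `η r`; `y 0 k` is a supporting point of `S` in direction
`l k`; and `y (i+1) k` is a supporting point in direction `l k` of the convex hull of the points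
obtained from `{y i k'}` and `{v r}` by one macro step. -/
structure IsRun (v : Fin D.numU → Euc m) (y : ℕ → Fin D.numR → Euc n) : Prop where
  control : ∀ r, v r ∈ supportFace (D.η r) P.U
  start : ∀ k, y 0 k ∈ supportFace (D.l k) P.S
  step : ∀ i, i < D.K → ∀ k, y (i + 1) k ∈
    supportFace (D.l k) (convexHull ℝ (D.macroStep P (Set.range v) i (Set.range (y i))))

/-- The fully discrete reachable set `R_{hΔ}(t_i)`, the convex hull of the computed supporting
points. -/
def discReach (y : ℕ → Fin D.numR → Euc n) (i : ℕ) : Set (Euc n) :=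
  convexHull ℝ (Set.range (y i))

/-- The computational domain `Ω = ⋃_{i=0,…,K} R_{hΔ}(t_i)`. -/
def domain (y : ℕ → Fin D.numR → Euc n) : Set (Euc n) :=
  ⋃ i ∈ Set.Iic D.K, D.discReach y i

/-- `Γ` is a simplicial triangulation of `Ω \ int R_{hΔ}(t₀)` into finitely many `n`-simplices
(and their faces) whose vertices are the computed supporting points, and each of whose simplices
lies in one of the layers `R_{hΔ}(t_{i+1}) \ int R_{hΔ}(t_i)`. -/
structure IsTriangulation (y : ℕ → Fin D.numR → Euc n)
    (Γ : Geometry.SimplicialComplex ℝ (Euc n)) : Prop where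
  finite : Γ.faces.Finite
  pure : ∀ s ∈ Γ.faces, ∃ s' ∈ Γ.faces, s ⊆ s' ∧ s'.card = n + 1
  space_eq : Γ.space = D.domain y \ interior (D.discReach y 0)
  vertices_eq : Γ.vertices = ⋃ i ∈ Set.Iic D.K, Set.range (y i)
  layer : ∀ s ∈ Γ.faces, ∃ i, i < D.K ∧
    convexHull ℝ (s : Set (Euc n)) ⊆ D.discReach y (i + 1) \ interior (D.discReach y i)

open Classical in
/-- The values prescribed on `R_{hΔ}(t₀)` (namely `t₀`) and on the boundaries
`∂R_{hΔ}(t_i)`, `i = 1, …, K` (namely `t_i`). -/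
def levelTime (y : ℕ → Fin D.numR → Euc n) (x : Euc n) : ℝ :=
  if x ∈ D.discReach y 0 then P.t₀
  else D.time P (sInf {i : ℕ | 1 ≤ i ∧ i ≤ D.K ∧ x ∈ frontier (D.discReach y i)})

end Discretization

open Classical in
/-- The piecewise linear interpolation over `Γ` of nodal values `f`: if `x = ∑ λ_v v` is a convex
combination of the vertices of a simplex of `Γ`, the value at `x` is `∑ λ_v f(v)`. In a simplicial
complex this depends neither on the simplex nor on the weights; outside of `Γ` it is `0`. -/
def simplicialInterp {n : ℕ} (Γ : Geometry.SimplicialComplex ℝ (Euc n)) (f : Euc n → ℝ)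
    (x : Euc n) : ℝ :=
  if hx : ∃ p : Finset (Euc n) × (Euc n → ℝ), p.1 ∈ Γ.faces ∧ (∀ v ∈ p.1, 0 ≤ p.2 v) ∧
      ∑ v ∈ p.1, p.2 v = 1 ∧ ∑ v ∈ p.1, p.2 v • v = x
  then ∑ v ∈ hx.choose.1, hx.choose.2 v * f v
  else 0

open Classical in
/-- The fully discrete minimum time function `T_{hΔ}`: the prescribed values on `R_{hΔ}(t₀)` and on
the boundaries of the `R_{hΔ}(t_i)`, and piecewise linear interpolation elsewhere in `Ω`. -/
def Discretization.discMinTime {n m : ℕ} (D : Discretization n m) (P : LinearControlSystem n m)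
    (y : ℕ → Fin D.numR → Euc n) (Γ : Geometry.SimplicialComplex ℝ (Euc n)) (x : Euc n) : ℝ :=
  if x ∈ D.discReach y 0 ∨ ∃ i, 1 ≤ i ∧ i ≤ D.K ∧ x ∈ frontier (D.discReach y i)
  then D.levelTime P y x
  else simplicialInterp Γ (D.levelTime P y) x

end

/-!
By Rådström cancellation, replacing `R(t_{i+1})` by a closed convex set at Hausdorff distance less
than `ε / 3` shrinks the gap between consecutive reachable sets by less than `ε / 3`; replacing
`R(t_i)` costs as much again. So the discrete sets are nested with gap `ε / 3`, and they interlace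
with the exact ones: `R(t_i) ⊆ R_{hΔ}(t_{i+1})` and `R_{hΔ}(t_i) ⊆ R(t_{i+1})`.
A point `x` of `R_{hΔ}(t_{j+1}) \ R_{hΔ}(t_j)` therefore has `T(x)` between `t_{j-1}` and `t_{j+2}`
(in the last layer the upper bound is `T(x) ≤ t_f + Δt`), whereas `T_{hΔ}(x)` lies between `t_j` and
`t_{j+1}`, because the vertices of the simplices in this layer are supporting points and hence carry
only the values `t_j` and `t_{j+1}`.
-/

open Metric Set

section PseudoEMetricSpace

variable {X : Type*} [PseudoEMetricSpace X] {s t u : Set X} {δ ε : ℝ}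

theorem subset_thickening_of_hausdorffEDist_lt (h : hausdorffEDist s t < ENNReal.ofReal δ) :
    s ⊆ thickening δ t :=
  fun _ hx => (infEDist_le_hausdorffEDist_of_mem hx).trans_lt h

theorem subset_of_hausdorffEDist_lt_of_thickening_subset
    (hst : hausdorffEDist s t < ENNReal.ofReal δ) (hδ : δ ≤ ε) (htu : thickening ε t ⊆ u) :
    s ⊆ u :=
  (subset_thickening_of_hausdorffEDist_lt hst).trans ((thickening_mono hδ t).trans htu)

end PseudoEMetricSpace

theorem thickening_subset_of_add_closedBall_subset {E : Type*} [SeminormedAddCommGroup E]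
    {s t : Set E} {ε : ℝ} (h : s + closedBall 0 ε ⊆ t) : thickening ε s ⊆ t := by
  rw [← add_ball_zero]
  exact (add_subset_add_left ball_subset_closedBall).trans h

section ConvexPerturbation

variable {E : Type*} [SeminormedAddCommGroup E] [NormedSpace ℝ E]

/-- Rådström cancellation. -/
theorem subset_closure_of_add_subset_add {A B C : Set E} (hC : Convex ℝ C)
    (hB : Bornology.IsBounded B) (hB' : B.Nonempty) (h : A + B ⊆ C + B) : A ⊆ closure C := by
  intro a ha
  by_contra haC
  obtain ⟨f, u, hfC, hfa⟩ := geometric_hahn_banach_closed_point hC.closure isClosed_closure haC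
  have hbdd : BddAbove (f '' B) := (f.lipschitz.isBounded_image hB).bddAbove
  have hsup : sSup (f '' B) ≤ u - f a + sSup (f '' B) := by
    refine csSup_le (hB'.image f) ?_
    rintro _ ⟨b, hb, rfl⟩
    obtain ⟨c, hc, b', hb', hcb⟩ := h (add_mem_add ha hb)
    have hf : f c + f b' = f a + f b := by rw [← map_add, ← map_add]; exact congrArg f hcb
    linarith [hfC c (subset_closure hc), le_csSup hbdd (mem_image_of_mem f hb')]
  linarith

theorem thickening_subset_of_thickening_add_subset {A C : Set E} {r σ : ℝ} (hr : 0 < r)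
    (hC : Convex ℝ C) (hC' : IsClosed C) (h : thickening (r + σ) A ⊆ thickening r C) :
    thickening σ A ⊆ C := by
  refine (subset_closure_of_add_subset_add hC isBounded_ball (nonempty_ball.2 hr)
    (B := ball 0 r) ?_).trans hC'.closure_subset
  rw [add_ball_zero, add_ball_zero]
  exact (thickening_thickening_subset r σ A).trans h

theorem add_closedBall_subset_interior_of_hausdorffEDist_lt {A C R : Set E} {σ δ : ℝ}
    (hC : Convex ℝ C) (hC' : IsClosed C) (hCR : hausdorffEDist C R < ENNReal.ofReal δ)
    (hAR : thickening (σ + δ) A ⊆ R) : A + closedBall 0 σ ⊆ interior C := by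
  obtain ⟨r, -, hr, hrδ⟩ := ENNReal.lt_iff_exists_real_btwn.1 hCR
  have hr₀ : 0 < r := ENNReal.ofReal_pos.1 hr.bot_lt
  rw [hausdorffEDist_comm] at hr
  have hthick : thickening (σ + δ - r) A ⊆ C :=
    thickening_subset_of_thickening_add_subset hr₀ hC hC' <| by
      rw [add_sub_cancel]
      exact hAR.trans (subset_thickening_of_hausdorffEDist_lt hr)
  have hσ : σ < σ + δ - r := by linarith [(ENNReal.ofReal_lt_ofReal_iff'.1 hrδ).1]
  calc A + closedBall (0 : E) σ
      ⊆ A + ball (0 : E) (σ + δ - r) := add_subset_add_left (closedBall_subset_ball hσ)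
    _ = thickening (σ + δ - r) A := add_ball_zero _ _
    _ ⊆ interior C := interior_maximal hthick isOpen_thickening

theorem subset_interior_of_thickening_subset_of_hausdorffEDist_lt {A C R : Set E} {δ ε : ℝ}
    (hC : Convex ℝ C) (hC' : IsClosed C) (hCR : hausdorffEDist C R < ENNReal.ofReal δ)
    (hδ : δ ≤ ε) (hAR : thickening ε A ⊆ R) : A ⊆ interior C := by
  refine (subset_add_left A (mem_closedBall_self le_rfl)).trans
    (add_closedBall_subset_interior_of_hausdorffEDist_lt hC hC' hCR ?_)
  rw [zero_add]
  exact (thickening_mono hδ A).trans hAR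

theorem add_closedBall_subset_interior_of_hausdorffEDist_lt₂ {C₀ C₁ R₀ R₁ : Set E}
    {σ δ₀ δ₁ ε : ℝ} (hC : Convex ℝ C₁) (hC' : IsClosed C₁)
    (h₀ : hausdorffEDist C₀ R₀ < ENNReal.ofReal δ₀)
    (h₁ : hausdorffEDist C₁ R₁ < ENNReal.ofReal δ₁) (hε : σ + δ₁ + δ₀ ≤ ε)
    (hR : thickening ε R₀ ⊆ R₁) : C₀ + closedBall 0 σ ⊆ interior C₁ := by
  refine add_closedBall_subset_interior_of_hausdorffEDist_lt hC hC' h₁ ?_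
  calc thickening (σ + δ₁) C₀
      ⊆ thickening (σ + δ₁) (thickening δ₀ R₀) :=
        thickening_subset_of_subset _ (subset_thickening_of_hausdorffEDist_lt h₀)
    _ ⊆ thickening (σ + δ₁ + δ₀) R₀ := thickening_thickening_subset _ _ _
    _ ⊆ thickening ε R₀ := thickening_mono hε R₀
    _ ⊆ R₁ := hR

end ConvexPerturbation

section SupportFace

variable {n : ℕ} {l x : Euc n} {A B : Set (Euc n)}

theorem supportFace_subset_frontier (hl : l ≠ 0) : supportFace l A ⊆ frontier A := by
  rintro x ⟨hx, hmax⟩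
  refine ⟨subset_closure hx, fun hint => hl ?_⟩
  have hloc : IsLocalMax (innerSL ℝ l) x :=
    Filter.mem_of_superset (mem_interior_iff_mem_nhds.1 hint) hmax
  have hzero : innerSL ℝ l = 0 := hloc.hasFDerivAt_eq_zero (innerSL ℝ l).hasFDerivAt
  rw [← norm_eq_zero, ← innerSL_apply_norm (𝕜 := ℝ) l, hzero, norm_zero]

theorem mem_supportFace_convexHull (hx : x ∈ supportFace l A) (hBA : B ⊆ A) (hxB : x ∈ B) :
    x ∈ supportFace l (convexHull ℝ B) := by
  refine ⟨subset_convexHull ℝ B hxB, fun z hz => ?_⟩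
  have hhalf : Convex ℝ {z | inner ℝ l z ≤ inner ℝ l x} :=
    convex_halfSpace_le (innerSL ℝ l).isLinear _
  exact convexHull_min (fun b hb => hx.2 b (hBA hb)) hhalf hz

end SupportFace

theorem simplicialInterp_mem_of_convex {n : ℕ} {Γ : Geometry.SimplicialComplex ℝ (Euc n)}
    {f : Euc n → ℝ} {x : Euc n} {I : Set ℝ} (hI : Convex ℝ I) (hx : x ∈ Γ.space)
    (hf : ∀ s ∈ Γ.faces, x ∈ convexHull ℝ (s : Set (Euc n)) → ∀ w ∈ s, f w ∈ I) :
    simplicialInterp Γ f x ∈ I := by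
  have hex : ∃ p : Finset (Euc n) × (Euc n → ℝ), p.1 ∈ Γ.faces ∧ (∀ v ∈ p.1, 0 ≤ p.2 v) ∧
      ∑ v ∈ p.1, p.2 v = 1 ∧ ∑ v ∈ p.1, p.2 v • v = x := by
    obtain ⟨s, hs, hxs⟩ := Geometry.SimplicialComplex.mem_space_iff.1 hx
    obtain ⟨w, hw₀, hw₁, hwx⟩ := Finset.mem_convexHull'.1 hxs
    exact ⟨(s, w), hs, hw₀, hw₁, hwx⟩
  rw [simplicialInterp, dif_pos hex]
  obtain ⟨hs, hw₀, hw₁, hwx⟩ := hex.choose_spec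
  exact hI.sum_mem hw₀ hw₁ (hf _ hs (Finset.mem_convexHull'.2 ⟨_, hw₀, hw₁, hwx⟩))

theorem ne_top_and_abs_toReal_sub_le {T : EReal} {a b c d : ℝ} (ha : (a : EReal) ≤ T)
    (hb : T ≤ b) (hac : c - d ≤ a) (hbc : b ≤ c + d) : T ≠ ⊤ ∧ |T.toReal - c| ≤ d := by
  have hT : T ≠ ⊤ := ne_top_of_le_ne_top (EReal.coe_ne_top b) hb
  have hT' : T ≠ ⊥ := ne_bot_of_le_ne_bot (EReal.coe_ne_bot a) ha
  lift T to ℝ using ⟨hT, hT'⟩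
  rw [EReal.coe_le_coe_iff] at ha hb
  refine ⟨hT, ?_⟩
  rw [EReal.toReal_coe, abs_sub_le_iff]
  constructor <;> linarith

namespace LinearControlSystem

variable {n m : ℕ} {P : LinearControlSystem n m} {x : Euc n} {t tf : ℝ}

theorem minTime_eq_iInf_reach (x : Euc n) :
    P.minTime x = ⨅ (t : ℝ) (_ : x ∈ P.reach t), (t : EReal) := by
  refine le_antisymm (le_iInf₂ ?_) (le_iInf₂ fun u y => le_iInf fun huy => le_iInf₂ fun t ht => ?_)
  · rintro t ⟨ht, u, y, hu, hy, hyS⟩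
    exact iInf₂_le_of_le u y (iInf_le_of_le ⟨hu, hy⟩ (iInf₂_le t ⟨ht, hyS⟩))
  · exact iInf₂_le t ⟨ht.1, u, y, huy.1, huy.2, ht.2⟩

theorem minTime_le_of_mem_reach (hx : x ∈ P.reach t) : P.minTime x ≤ t := by
  rw [minTime_eq_iInf_reach]
  exact iInf₂_le t hx

theorem t₀_le_minTime (x : Euc n) : (P.t₀ : EReal) ≤ P.minTime x := by
  rw [minTime_eq_iInf_reach]
  exact le_iInf₂ fun _ hs => EReal.coe_le_coe hs.1

theorem le_minTime_of_notMem_reach (hmono : MonotoneOn P.reach (Icc P.t₀ tf)) (ht : t ≤ tf)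
    (hx : x ∉ P.reach t) : (t : EReal) ≤ P.minTime x := by
  rw [minTime_eq_iInf_reach]
  refine le_iInf₂ fun s hs => EReal.coe_le_coe ?_
  by_contra! hst
  exact hx (hmono ⟨hs.1, hst.le.trans ht⟩ ⟨hs.1.trans hst.le, ht⟩ hst.le hs)

theorem StandingAssumptions.monotoneOn_reach (hP : P.StandingAssumptions tf) :
    MonotoneOn P.reach (Icc P.t₀ tf) :=
  monotoneOn_iff_forall_lt.2 fun s hs t ht hst =>
    (hP.strictly_expanding s t hs.1 hst ht.2).trans interior_subset

end LinearControlSystem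

namespace Discretization

variable {n m : ℕ} {D : Discretization n m} {P : LinearControlSystem n m}
  {v : Fin D.numU → Euc m} {y : ℕ → Fin D.numR → Euc n} {i j : ℕ} {x : Euc n}

theorem dt_pos (h : P.t₀ < D.tf) : 0 < D.dt P :=
  div_pos (sub_pos.2 h) (Nat.cast_pos.2 D.K_pos)

theorem time_zero : D.time P 0 = P.t₀ := by simp [time]

theorem time_succ (i : ℕ) : D.time P (i + 1) = D.time P i + D.dt P := by
  simp only [time, Nat.cast_succ]; ring

theorem time_K : D.time P D.K = D.tf := by
  have hK : (D.K : ℝ) ≠ 0 := Nat.cast_ne_zero.2 D.K_pos.ne'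
  simp only [time, dt]; field_simp; ring

theorem time_mono (h : P.t₀ < D.tf) : Monotone (D.time P) :=
  monotone_nat_of_le_succ fun i => by rw [time_succ]; linarith [dt_pos h]

theorem isClosed_discReach (i : ℕ) : IsClosed (D.discReach y i) :=
  ((finite_range _).isCompact_convexHull ℝ).isClosed

theorem convex_discReach (i : ℕ) : Convex ℝ (D.discReach y i) := convex_convexHull ℝ _

theorem frontier_discReach_subset (i : ℕ) : frontier (D.discReach y i) ⊆ D.discReach y i :=
  (isClosed_discReach i).frontier_subset

theorem IsRun.mem_frontier (hrun : D.IsRun P v y) (hi : i ≤ D.K) (k : Fin D.numR) :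
    y i k ∈ frontier (D.discReach y i) := by
  have hl : D.l k ≠ 0 := norm_ne_zero_iff.1 (by rw [D.l_unit]; exact one_ne_zero)
  refine supportFace_subset_frontier hl ?_
  cases i with
  | zero =>
    exact mem_supportFace_convexHull (hrun.start k)
      (range_subset_iff.2 fun k => (hrun.start k).1) (mem_range_self k)
  | succ i =>
    exact mem_supportFace_convexHull (hrun.step i hi k)
      (range_subset_iff.2 fun k => (hrun.step i hi k).1) (mem_range_self k)

theorem exists_layer_of_mem_domain (hx : x ∈ D.domain y) :
    x ∈ D.discReach y 0 ∨ ∃ j < D.K, x ∈ D.discReach y (j + 1) ∧ x ∉ D.discReach y j := by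
  obtain ⟨i, hi, hxi⟩ := mem_iUnion₂.1 hx
  induction i with
  | zero => exact .inl hxi
  | succ i ih =>
    by_cases hxi' : x ∈ D.discReach y i
    · exact ih (Nat.le_of_succ_le hi) hxi'
    · exact .inr ⟨i, hi, hxi, hxi'⟩

variable (D y) in
/-- The discrete counterpart of the expansion property of the exact reachable sets, on the grid
`t₀, …, t_K` only: it keeps the boundaries `∂R_{hΔ}(t_i)` disjoint, so that the layers between them
and the level times on them are unambiguous. -/
def StrictlyExpanding : Prop :=
  ∀ i < D.K, D.discReach y i ⊆ interior (D.discReach y (i + 1))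

namespace StrictlyExpanding

theorem subset (hD : D.StrictlyExpanding y) (hij : i ≤ j) (hj : j ≤ D.K) :
    D.discReach y i ⊆ D.discReach y j := by
  induction j, hij using Nat.le_induction with
  | base => exact Subset.rfl
  | succ j _ ih => exact (ih (Nat.le_of_succ_le hj)).trans ((hD j hj).trans interior_subset)

theorem subset_interior (hD : D.StrictlyExpanding y) (hij : i < j) (hj : j ≤ D.K) :
    D.discReach y i ⊆ interior (D.discReach y j) :=
  (hD i (hij.trans_le hj)).trans (interior_mono (hD.subset hij hj))

theorem le_of_mem_frontier (hD : D.StrictlyExpanding y) (hi : i ≤ D.K)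
    (hxi : x ∈ frontier (D.discReach y i)) (hxj : x ∈ D.discReach y j) : i ≤ j := by
  by_contra! hji
  exact hxi.2 (hD.subset_interior hji hi hxj)

theorem domain_subset (hD : D.StrictlyExpanding y) : D.domain y ⊆ D.discReach y D.K :=
  iUnion₂_subset fun _ hi => hD.subset hi le_rfl

theorem levelTime_of_mem_frontier (hD : D.StrictlyExpanding y) (hi : i ≤ D.K)
    (hx : x ∈ frontier (D.discReach y i)) : D.levelTime P y x = D.time P i := by
  have hxi := frontier_discReach_subset i hx
  by_cases h₀ : x ∈ D.discReach y 0
  · rw [levelTime, if_pos h₀, Nat.le_zero.1 (hD.le_of_mem_frontier hi hx h₀), time_zero]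
  · have hlevels : {j : ℕ | 1 ≤ j ∧ j ≤ D.K ∧ x ∈ frontier (D.discReach y j)} = {i} := by
      ext j
      refine ⟨fun ⟨_, hj, hxj⟩ => le_antisymm (hD.le_of_mem_frontier hj hxj hxi)
        (hD.le_of_mem_frontier hi hx (frontier_discReach_subset j hxj)), ?_⟩
      rintro rfl
      exact ⟨Nat.one_le_iff_ne_zero.2 fun h => h₀ (h ▸ hxi), hi, hx⟩
    rw [levelTime, if_neg h₀, hlevels, csInf_singleton]

theorem levelTime_mem_Icc (hD : D.StrictlyExpanding y) (ht : P.t₀ < D.tf) (hi : i ≤ D.K)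
    (hj : j < D.K) (hxi : x ∈ frontier (D.discReach y i))
    (hx : x ∈ D.discReach y (j + 1) \ interior (D.discReach y j)) :
    D.levelTime P y x ∈ Icc (D.time P j) (D.time P (j + 1)) := by
  have hji : j ≤ i := by
    by_contra! hij
    exact hx.2 (hD.subset_interior hij hj.le (frontier_discReach_subset i hxi))
  rw [hD.levelTime_of_mem_frontier hi hxi]
  exact ⟨time_mono ht hji, time_mono ht (hD.le_of_mem_frontier hi hxi hx.1)⟩

theorem layer_unique (hD : D.StrictlyExpanding y) (hi : i < D.K) (hj : j < D.K)
    (hxi : x ∈ D.discReach y (i + 1) \ interior (D.discReach y i))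
    (hxj : x ∈ interior (D.discReach y (j + 1)) \ D.discReach y j) : i = j := by
  refine le_antisymm ?_ ?_
  · by_contra! hji
    exact hxi.2 (interior_mono (hD.subset hji hi.le) hxj.1)
  · by_contra! hij
    exact hxj.2 (hD.subset hij hj.le hxi.1)

end StrictlyExpanding

variable {Γ : Geometry.SimplicialComplex ℝ (Euc n)}

theorem IsTriangulation.exists_mem_frontier (hΓ : D.IsTriangulation y Γ) (hrun : D.IsRun P v y)
    {s : Finset (Euc n)} (hs : s ∈ Γ.faces) {w : Euc n} (hw : w ∈ s) :
    ∃ i ≤ D.K, w ∈ frontier (D.discReach y i) := by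
  have hwΓ : w ∈ Γ.vertices :=
    Γ.down_closed hs (Finset.singleton_subset_iff.2 hw) (Finset.singleton_nonempty w)
  rw [hΓ.vertices_eq] at hwΓ
  obtain ⟨i, hi, k, rfl⟩ := mem_iUnion₂.1 hwΓ
  exact ⟨i, hi, hrun.mem_frontier hi k⟩

theorem IsTriangulation.simplicialInterp_mem_Icc (hΓ : D.IsTriangulation y Γ)
    (hrun : D.IsRun P v y) (hD : D.StrictlyExpanding y) (ht : P.t₀ < D.tf) (hj : j < D.K)
    (hx : x ∈ interior (D.discReach y (j + 1)) \ D.discReach y j) :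
    simplicialInterp Γ (D.levelTime P y) x ∈ Icc (D.time P j) (D.time P (j + 1)) := by
  have hxΓ : x ∈ Γ.space := by
    rw [hΓ.space_eq]
    exact ⟨mem_biUnion (mem_Iic.2 hj) (interior_subset hx.1),
      fun h₀ => hx.2 (hD.subset (Nat.zero_le j) hj.le (interior_subset h₀))⟩
  refine simplicialInterp_mem_of_convex (convex_Icc _ _) hxΓ fun s hs hxs w hw => ?_
  obtain ⟨i, hi, hlayer⟩ := hΓ.layer s hs
  obtain rfl : i = j := hD.layer_unique hi hj (hlayer hxs) hx
  obtain ⟨k, hk, hwk⟩ := hΓ.exists_mem_frontier hrun hs hw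
  exact hD.levelTime_mem_Icc ht hk hi hwk (hlayer (subset_convexHull ℝ _ hw))

theorem discMinTime_of_mem_discReach_zero (hx : x ∈ D.discReach y 0) :
    D.discMinTime P y Γ x = P.t₀ := by
  rw [discMinTime, if_pos (.inl hx), levelTime, if_pos hx]

theorem IsTriangulation.discMinTime_mem_Icc (hΓ : D.IsTriangulation y Γ)
    (hrun : D.IsRun P v y) (hD : D.StrictlyExpanding y) (ht : P.t₀ < D.tf) (hj : j < D.K)
    (hx : x ∈ D.discReach y (j + 1)) (hx' : x ∉ D.discReach y j) :
    D.discMinTime P y Γ x ∈ Icc (D.time P j) (D.time P (j + 1)) := by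
  rw [discMinTime]
  split_ifs with hlevel
  · rcases hlevel with h₀ | ⟨i, -, hi, hxi⟩
    · exact absurd (hD.subset (Nat.zero_le j) hj.le h₀) hx'
    · exact hD.levelTime_mem_Icc ht hi hj hxi ⟨hx, fun h => hx' (interior_subset h)⟩
  · have hint : x ∈ interior (D.discReach y (j + 1)) := by
      by_contra hint
      exact hlevel (.inr ⟨j + 1, Nat.le_add_left 1 j, hj, subset_closure hx, hint⟩)
    exact hΓ.simplicialInterp_mem_Icc hrun hD ht hj ⟨hint, hx'⟩

theorem time_sub_dt_le_minTime (hmono : MonotoneOn P.reach (Icc P.t₀ D.tf)) (ht : P.t₀ < D.tf)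
    (hreach : ∀ i < D.K, P.reach (D.time P i) ⊆ D.discReach y (i + 1))
    (hj : j ≤ D.K) (hx : x ∉ D.discReach y j) :
    ((D.time P j - D.dt P : ℝ) : EReal) ≤ P.minTime x := by
  cases j with
  | zero =>
    refine le_trans (EReal.coe_le_coe ?_) (P.t₀_le_minTime x)
    rw [time_zero]
    linarith [dt_pos ht]
  | succ i =>
    rw [time_succ, add_sub_cancel_right]
    exact P.le_minTime_of_notMem_reach hmono ((time_mono ht (Nat.le_of_succ_le hj)).trans_eq time_K)
      fun h => hx (hreach i hj h)

theorem minTime_le_tf_add_dt (ht : P.t₀ < D.tf) (hj : j < D.K)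
    (hx : x ∈ P.reach (D.time P (j + 1))) : P.minTime x ≤ (D.tf + D.dt P : ℝ) := by
  refine (P.minTime_le_of_mem_reach hx).trans (EReal.coe_le_coe ?_)
  calc D.time P (j + 1) ≤ D.tf := (time_mono ht hj).trans_eq time_K
    _ ≤ D.tf + D.dt P := le_add_of_nonneg_right (dt_pos ht).le

theorem minTime_le_time_add_dt
    (hdisc : ∀ i < D.K, D.discReach y i ⊆ P.reach (D.time P (i + 1)))
    (hT : P.minTime x ≤ (D.tf + D.dt P : ℝ)) (hj : j ≤ D.K) (hx : x ∈ D.discReach y j) :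
    P.minTime x ≤ (D.time P j + D.dt P : ℝ) := by
  rcases hj.lt_or_eq with hj | rfl
  · rw [← time_succ]
    exact P.minTime_le_of_mem_reach (hdisc j hj hx)
  · rwa [time_K]

theorem IsTriangulation.abs_minTime_sub_discMinTime_le (hΓ : D.IsTriangulation y Γ)
    (hrun : D.IsRun P v y) (hD : D.StrictlyExpanding y) (ht : P.t₀ < D.tf)
    (hmono : MonotoneOn P.reach (Icc P.t₀ D.tf))
    (hreach : ∀ i < D.K, P.reach (D.time P i) ⊆ D.discReach y (i + 1))
    (hdisc : ∀ i < D.K, D.discReach y i ⊆ P.reach (D.time P (i + 1)))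
    (hx : x ∈ D.domain y) (hT : P.minTime x ≤ (D.tf + D.dt P : ℝ)) :
    P.minTime x ≠ ⊤ ∧ |(P.minTime x).toReal - D.discMinTime P y Γ x| ≤ 2 * D.dt P := by
  have hdt := dt_pos ht
  rcases exists_layer_of_mem_domain hx with h₀ | ⟨j, hj, hxj, hxj'⟩
  · have hupper := minTime_le_time_add_dt hdisc hT (Nat.zero_le _) h₀
    rw [time_zero] at hupper
    rw [discMinTime_of_mem_discReach_zero h₀]
    exact ne_top_and_abs_toReal_sub_le (P.t₀_le_minTime x) hupper (by linarith) (by linarith)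
  · obtain ⟨hlow, hhigh⟩ := hΓ.discMinTime_mem_Icc hrun hD ht hj hxj hxj'
    rw [time_succ] at hhigh
    have hupper := minTime_le_time_add_dt hdisc hT hj hxj
    rw [time_succ] at hupper
    exact ne_top_and_abs_toReal_sub_le (time_sub_dt_le_minTime hmono ht hreach hj.le hxj') hupper
      (by linarith) (by linarith)

end Discretization

theorem proposition3p7_general {n m : ℕ} (P : LinearControlSystem n m) (D : Discretization n m)
    (ht : P.t₀ < D.tf) (hmono : MonotoneOn P.reach (Icc P.t₀ D.tf))
    (v : Fin D.numU → Euc m) (y : ℕ → Fin D.numR → Euc n) (hrun : D.IsRun P v y) (ε : ℝ)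
    (hdist : ∀ i ≤ D.K, hausdorffEDist (D.discReach y i) (P.reach (D.time P i)) <
      ENNReal.ofReal (ε / 3))
    (hnest : ∀ i < D.K, P.reach (D.time P i) + closedBall 0 ε ⊆
      interior (P.reach (D.time P (i + 1)))) :
    (∀ i < D.K, D.discReach y i + closedBall 0 (ε / 3) ⊆ interior (D.discReach y (i + 1))) ∧
    ∀ Γ : Geometry.SimplicialComplex ℝ (Euc n), D.IsTriangulation y Γ →
      (∀ x ∈ D.domain y,
        ((∃ i < D.K, x ∈ D.discReach y i) ∨ P.minTime x ≤ (D.tf + D.dt P : ℝ)) →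
          P.minTime x ≠ ⊤ ∧ |(P.minTime x).toReal - D.discMinTime P y Γ x| ≤ 2 * D.dt P) ∧
      (P.reach D.tf + closedBall 0 ε ⊆ interior (P.reach (D.tf + D.dt P)) →
        ∀ x ∈ D.domain y,
          P.minTime x ≠ ⊤ ∧ |(P.minTime x).toReal - D.discMinTime P y Γ x| ≤ 2 * D.dt P) := by
  have hε : 0 < ε / 3 := ENNReal.ofReal_pos.1 (hdist 0 (Nat.zero_le _)).bot_lt
  have hthick : ∀ i < D.K, thickening ε (P.reach (D.time P i)) ⊆ P.reach (D.time P (i + 1)) :=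
    fun i hi => thickening_subset_of_add_closedBall_subset ((hnest i hi).trans interior_subset)
  have hgap : ∀ i < D.K, D.discReach y i + closedBall 0 (ε / 3) ⊆
      interior (D.discReach y (i + 1)) := fun i hi =>
    add_closedBall_subset_interior_of_hausdorffEDist_lt₂ (D.convex_discReach _)
      (D.isClosed_discReach _) (hdist i hi.le) (hdist (i + 1) hi) (add_thirds ε).le (hthick i hi)
  have hD : D.StrictlyExpanding y := fun i hi =>
    (subset_add_left _ (mem_closedBall_self hε.le)).trans (hgap i hi)
  have hreach : ∀ i < D.K, P.reach (D.time P i) ⊆ D.discReach y (i + 1) := fun i hi =>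
    (subset_interior_of_thickening_subset_of_hausdorffEDist_lt (D.convex_discReach _)
      (D.isClosed_discReach _) (hdist (i + 1) hi) (by linarith) (hthick i hi)).trans
      interior_subset
  have hdisc : ∀ i < D.K, D.discReach y i ⊆ P.reach (D.time P (i + 1)) := fun i hi =>
    subset_of_hausdorffEDist_lt_of_thickening_subset (hdist i hi.le) (by linarith) (hthick i hi)
  refine ⟨hgap, fun Γ hΓ => ⟨fun x hx hcase => ?_, fun hfinal x hx => ?_⟩⟩ <;>
    refine hΓ.abs_minTime_sub_discMinTime_le hrun hD ht hmono hreach hdisc hx ?_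
  · rcases hcase with ⟨i, hi, hxi⟩ | hT
    · exact D.minTime_le_tf_add_dt ht hi (hdisc i hi hxi)
    · exact hT
  · have hK := hdist D.K le_rfl
    rw [D.time_K] at hK
    exact P.minTime_le_of_mem_reach <|
      subset_of_hausdorffEDist_lt_of_thickening_subset hK (by linarith)
        (thickening_subset_of_add_closedBall_subset (hfinal.trans interior_subset))
        (hD.domain_subset hx)

theorem proposition3p7 {n m : ℕ} (P : LinearControlSystem n m) (D : Discretization n m)
    (hP : P.StandingAssumptions D.tf)
    (v : Fin D.numU → Euc m) (y : ℕ → Fin D.numR → Euc n) (hrun : D.IsRun P v y)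
    (C p ε : ℝ) (hC : 0 ≤ C) (hε : 0 < ε)
    (hdist : ∀ i ≤ D.K, Metric.hausdorffEDist (D.discReach y i) (P.reach (D.time P i)) ≤
      ENNReal.ofReal (C * D.h P ^ p))
    (hnest : ∀ i < D.K, P.reach (D.time P i) + Metric.closedBall 0 ε ⊆
      interior (P.reach (D.time P (i + 1))))
    (hsmall : C * D.h P ^ p < ε / 3) :
    (∀ i < D.K, D.discReach y i + Metric.closedBall 0 (ε / 3) ⊆
      interior (D.discReach y (i + 1))) ∧
    ∀ Γ : Geometry.SimplicialComplex ℝ (Euc n), D.IsTriangulation y Γ →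
      (∀ x ∈ D.domain y,
        ((∃ i < D.K, x ∈ D.discReach y i) ∨ P.minTime x ≤ (D.tf + D.dt P : ℝ)) →
          P.minTime x ≠ ⊤ ∧ |(P.minTime x).toReal - D.discMinTime P y Γ x| ≤ 2 * D.dt P) ∧
      (P.reach D.tf + Metric.closedBall 0 ε ⊆ interior (P.reach (D.tf + D.dt P)) →
        ∀ x ∈ D.domain y,
          P.minTime x ≠ ⊤ ∧ |(P.minTime x).toReal - D.discMinTime P y Γ x| ≤ 2 * D.dt P) :=
  proposition3p7_general P D hP.t₀_lt hP.monotoneOn_reach v y hrun ε (fun i hi =>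
    (hdist i hi).trans_lt ((ENNReal.ofReal_lt_ofReal_iff (by positivity)).2 hsmall)) hnest
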